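/- **Setting.** A flow of a monoid $\mathbb M$ on an object $X$ of a category $\mathcal C$ is a monoid morphism $\mathbb M\to\mathcal C(X,X)$; for categories of topological or uniform spaces we write it as a map $\mathbb M\times X\to X$, $(s,x)\mapsto sx$. For a family $\mathcal F$ of conditions on flows, ${}_{\mathcal F}\mathcal C^{\mathbb M}$ is the category of flows in $\mathcal C$ meeting $\mathcal F$, with the equivariant $\mathcal C$-morphisms. A full inclusion is *reflective* if it has a left adjoint. For families $\mathcal S,\mathcal S'\subseteq 2^{\mathbb M}$ write $\mathcal S\preceq\mathcal S'$ if every $S\in\mathcal S$ is contained in some $S'\in\mathcal S'$ (so $\mathcal S'$ arises by enlarging the family and/or its members). **Theorem.** In each of the following cases $\mathcal F'$ is at least as demanding as $\mathcal F$, and the resulting full inclusion ${}_{\mathcal F'}\mathcal C^{\mathbb M}\subseteq{}_{\mathcal F}\mathcal C^{\mathbb M}$ is reflective. 1. $\mathbb M$ is a topological monoid; $\mathcal C$ is the category of all, $T_0$, $T_1$, Hausdorff, functionally Hausdorff, Tychonoff, or compact Hausdorff topological spaces; $\mathcal S\preceq\mathcal S'$ and $\mathcal J\preceq\mathcal J'$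 are families of subsets of $\mathbb M$; $\mathcal F$ requires $\mathbb M\times X\to X$ to be separately continuous over $S\times X$ for $S\in\mathcal S$ and jointly continuous over $J\times X$ for $J\in\mathcal J$; $\mathcal F'$ is the same requirement for $\mathcal S',\mathcal J'$. 2. $\mathbb M$ is a monoid equipped with a uniformity; $\mathcal C$ is the category of all, Hausdorff, or complete Hausdorff uniform spaces (with uniformly continuous maps); $\mathcal S\preceq\mathcal S'$ and $\mathcal J\preceq\mathcal J'$; $\mathcal F$ requires the action to be separately uniformly continuous over $S\times X$, $S\in\mathcal S$, and jointly uniformly continuous over $J\times X$, $J\in\mathcal J$; $\mathcal F'$ is the same requirement for $\mathcal S',\mathcal J'$. 3. $\mathbb M$ is a monoid internal to the category of compactly generated spaces (a set is open if and only if its intersection with every compact subspace is open in that subspace) with its product $Y\times^\kappa Z=\kappa(Y\times Z)$, where $\kappa$ is the coreflection of topological spaces onto compactly generated ones; $\mathcal C$ is the category of all, or of Hausdorff, compactly generated spaces; $\mathcal S\preceq\mathcal S'$ and $\mathcal J\preceq\mathcal J'$; $\mathcal F$ requires the action to be separately continuous over $\kappa(S)\times X$, $S\in\mathcal S$, and continuous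 on $\kappa(J)\times^\kappa X$, $J\in\mathcal J$; $\mathcal F'$ is the same requirement for $\mathcal S',\mathcal J'$. 4. $\mathbb M=\mathbb G$ is a topological group, $\mathcal C$ is as in 2, $\mathcal F$ is *quasi-boundedness* (for every entourage $W$ of $X$ there are a neighborhood $N$ of $1\in\mathbb G$ and an entourage $V$ with $(sx,sy)\in W$ for all $s\in N$, $(x,y)\in V$), and $\mathcal F'$ is *boundedness* (for every entourage $V$ of $X$ there is a neighborhood $N$ of $1$ with $(sy,y)\in V$ for all $s\in N$, $y\in X$). 5. $\mathbb G$ and $\mathcal C$ are as in 4, $\mathcal F$ is boundedness, and $\mathcal F'$ is joint uniform continuity of $\mathbb G\times X\to X$, where $\mathbb G$ carries its left, its right, or its bilateral uniformity (the latter being the coarsest uniformity finer than the left and right ones). Moreover, in case 4 with $\mathcal C$ the category of all uniform spaces, the reflection recovers Megrelishvili's construction $(X,\mathcal U)\mapsto(X,\mathcal U^{\mathbb G})$: the unit of the reflection at a quasi-bounded flow $(X,\mathcal U)$ is a bijection, and, transported to $X$ along it, the uniformity of the reflection is the one with base $$\{(x,y)\in X^2 : \exists\, s,t\in N,\ (sx,ty)\in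 V\},\qquad N\text{ a neighborhood of }1\in\mathbb G,\ V\in\mathcal U.$$ -/

import Mathlib

open CategoryTheory Topology Uniformity

universe u v

/-- `𝒮'` is obtained from the family `𝒮` by enlarging the family and/or enlarging individual
members of it: every member of `𝒮` is contained in some member of `𝒮'`. (In particular this holds
whenever `𝒮 ⊆ 𝒮'`.) -/
def FamilyEnlarges {M : Type u} (𝒮 𝒮' : Set (Set M)) : Prop :=
  ∀ S ∈ 𝒮, ∃ S' ∈ 𝒮', S ⊆ S'

/-- The condition `P'` on objects of `D` is at least as strong as `P`, and the resulting inclusion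
of the full subcategory cut out by `P'` into the one cut out by `P` is reflective (it is full and
faithful and has a left adjoint). -/
def IsReflectiveStrengthening {D : Type*} [Category D] (P P' : ObjectProperty D) : Prop :=
  ∃ h : P' ≤ P, Nonempty (Reflective (ObjectProperty.ιOfLE h))

/-! ### Categories of topological spaces and their flows -/

/-- Functionally Hausdorff spaces: distinct points are separated by a continuous real function. -/
def FunctionallyHausdorff (X : Type v) [TopologicalSpace X] : Prop :=
  ∀ x y : X, x ≠ y → ∃ f : X → ℝ, Continuous f ∧ f x ≠ f y

/-- Names for the full subcategories of `Top` under consideration. -/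
inductive TopKind
  | blank | T0 | T1 | T2 | T2f | Tychonoff | compactT2

/-- The property of topological spaces defining each of the full subcategories. -/
def TopKind.prop : TopKind → ObjectProperty TopCat.{v}
  | .blank => fun _ => True
  | .T0 => fun X => T0Space X
  | .T1 => fun X => T1Space X
  | .T2 => fun X => T2Space X
  | .T2f => fun X => FunctionallyHausdorff X
  | .Tychonoff => fun X => T35Space X
  | .compactT2 => fun X => CompactSpace X ∧ T2Space X

/-- Names for the categories of compactly generated spaces under consideration. -/
inductive KTopKind
  | blank | T2

/-- Compactly generated spaces (a set is open as soon as its trace on every compact subspace is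
open there), respectively compactly generated Hausdorff spaces. -/
def KTopKind.prop : KTopKind → ObjectProperty TopCat.{v}
  | .blank => fun X => CompactlyCoherentSpace X
  | .T2 => fun X => CompactlyCoherentSpace X ∧ T2Space X

/-- Flows of the monoid `M` in the full subcategory `C` of `Top` cut out by `P`: objects `X` of `C`
with a monoid morphism `M → C(X, X)`. Morphisms are the equivariant morphisms of `C`. -/
abbrev TopFlow (P : ObjectProperty TopCat.{v}) (M : Type u) [Monoid M] :=
  Action P.FullSubcategory M

namespace TopFlow

variable {P : ObjectProperty TopCat.{v}} {M : Type u} [Monoid M]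

/-- The space underlying a flow. -/
abbrev Carrier (A : TopFlow P M) : Type v := A.V.obj

/-- The uncurried action map of a flow. -/
def act (A : TopFlow P M) (m : M) (x : A.Carrier) : A.Carrier :=
  ConcreteCategory.hom (InducedCategory.Hom.hom (A.ρ m)) x

/-- The action is separately continuous over `S × X`, `S ∈ 𝒮`, and jointly continuous over
`J × X`, `J ∈ 𝒥`. -/
def Constraint [TopologicalSpace M] (𝒮 𝒥 : Set (Set M)) : ObjectProperty (TopFlow P M) :=
  fun A =>
    (∀ S ∈ 𝒮, (∀ s : S, Continuous fun x : A.Carrier => A.act s x) ∧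
      ∀ x : A.Carrier, Continuous fun s : S => A.act s x) ∧
    ∀ J ∈ 𝒥, Continuous fun p : J × A.Carrier => A.act p.1 p.2

/-- The action is separately continuous over `κ(S) × X`, `S ∈ 𝒮`, and jointly continuous over the
`κ`-product `κ(J) ×^κ X = κ(κ(J) × X)`, `J ∈ 𝒥`; here `κ` is the coreflection onto compactly
generated spaces. -/
def KConstraint [TopologicalSpace M] (𝒮 𝒥 : Set (Set M)) : ObjectProperty (TopFlow P M) :=
  fun A =>
    (∀ S ∈ 𝒮, (∀ s : S, Continuous fun x : A.Carrier => A.act s x) ∧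
      ∀ x : A.Carrier, Continuous fun s : CompactCoherentification S =>
        A.act ((CompactCoherentification.mk S).symm s) x) ∧
    ∀ J ∈ 𝒥, Continuous fun p : CompactCoherentification (CompactCoherentification J × A.Carrier) =>
      A.act
        ((CompactCoherentification.mk J).symm ((CompactCoherentification.mk _).symm p).1)
        ((CompactCoherentification.mk _).symm p).2

end TopFlow

/-- `M` is a monoid internal to the category of compactly generated spaces with the `κ`-product:
it is compactly generated, and its multiplication is continuous on `M ×^κ M = κ(M × M)`. -/
class IsKMonoid (M : Type u) [Monoid M] [TopologicalSpace M] : Prop where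
  compactlyCoherent : CompactlyCoherentSpace M
  continuous_mul : Continuous fun p : CompactCoherentification (M × M) =>
    ((CompactCoherentification.mk _).symm p).1 * ((CompactCoherentification.mk _).symm p).2

/-! ### Categories of uniform spaces and their flows -/

/-- Names for the full subcategories of `Unif` under consideration. -/
inductive UnifKind
  | blank | T2 | completeT2

/-- The property of uniform spaces defining each of the full subcategories. -/
def UnifKind.prop : UnifKind → ObjectProperty UniformSpaceCat.{v}
  | .blank => fun _ => True
  | .T2 => fun X => T2Space X
  | .completeT2 => fun X => T2Space X ∧ CompleteSpace X

/-- Flows of the monoid `M` in the full subcategory `C` of `Unif` cut out by `P`: objects `X` of `C`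
with a monoid morphism `M → C(X, X)`. Morphisms are the equivariant morphisms of `C`. -/
abbrev UnifFlow (P : ObjectProperty UniformSpaceCat.{v}) (M : Type u) [Monoid M] :=
  Action P.FullSubcategory M

namespace UnifFlow

variable {P : ObjectProperty UniformSpaceCat.{v}}

section

variable {M : Type u} [Monoid M]

/-- The uniform space underlying a flow. -/
abbrev Carrier (A : UnifFlow P M) : Type v := A.V.obj

/-- The uncurried action map of a flow. -/
def act (A : UnifFlow P M) (m : M) (x : A.Carrier) : A.Carrier :=
  ConcreteCategory.hom (InducedCategory.Hom.hom (A.ρ m)) x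

/-- The function underlying a morphism of flows. -/
def mapFun {A B : UnifFlow P M} (f : A ⟶ B) (x : A.Carrier) : B.Carrier :=
  ConcreteCategory.hom (InducedCategory.Hom.hom f.hom) x

/-- The action is separately uniformly continuous over `S × X`, `S ∈ 𝒮`, and jointly uniformly
continuous over `J × X`, `J ∈ 𝒥`. -/
def Constraint [UniformSpace M] (𝒮 𝒥 : Set (Set M)) : ObjectProperty (UnifFlow P M) :=
  fun A =>
    (∀ S ∈ 𝒮, (∀ s : S, UniformContinuous fun x : A.Carrier => A.act s x) ∧
      ∀ x : A.Carrier, UniformContinuous fun s : S => A.act s x) ∧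
    ∀ J ∈ 𝒥, UniformContinuous fun p : J × A.Carrier => A.act p.1 p.2

/-- The action `M × X → X` is jointly uniformly continuous for the uniformity `𝒰` on `M`. -/
def JointlyUniform (𝒰 : UniformSpace M) : ObjectProperty (UnifFlow P M) :=
  fun A => UniformContinuous fun p : M × A.Carrier => A.act p.1 p.2

end

section

variable {G : Type u} [Group G] [TopologicalSpace G]

/-- Bounded flows. -/
def Bounded : ObjectProperty (UnifFlow P G) :=
  fun A => ∀ V ∈ 𝓤 A.Carrier, ∃ N ∈ 𝓝 (1 : G), ∀ s ∈ N, ∀ y : A.Carrier, (A.act s y, y) ∈ V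

/-- Quasi-bounded flows. -/
def QuasiBounded : ObjectProperty (UnifFlow P G) :=
  fun A => ∀ W ∈ 𝓤 A.Carrier, ∃ N ∈ 𝓝 (1 : G), ∃ V ∈ 𝓤 A.Carrier,
    ∀ s ∈ N, ∀ x y : A.Carrier, (x, y) ∈ V → (A.act s x, A.act s y) ∈ W

end

end UnifFlow

/-- Names for the standard uniformities of a topological group. -/
inductive GroupUniformity
  | left | right | bilateral

/-- The standard uniformities of a topological group: left (`s⁻¹ s'` close to `1`), right
(`s' s⁻¹` close to `1`), and bilateral, the coarsest uniformity finer than both. -/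
@[reducible] def GroupUniformity.uniformSpace (G : Type u) [Group G] [TopologicalSpace G]
    [IsTopologicalGroup G] : GroupUniformity → UniformSpace G
  | .left => IsTopologicalGroup.leftUniformSpace G
  | .right => IsTopologicalGroup.rightUniformSpace G
  | .bilateral => IsTopologicalGroup.leftUniformSpace G ⊓ IsTopologicalGroup.rightUniformSpace G

/-! A reflection amounts to a universal arrow from each object, and these arrows come from a
solution-set argument. Every condition in question is inherited by flows carrying the initial
structure for equivariant maps into flows that satisfy it, hence by products and invariant
subspaces: continuity into such a flow is tested after each map, where equivariance turns the action
into that of the target. Any family of morphisms out of `A` therefore factors through the image of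
`A` in a product. For compact Hausdorff and complete Hausdorff spaces, the closure of the image is
used instead.

Such images are classified by small data on `A`: the kernel and the induced structure for
surjections, the pulled-back uniformity for dense maps into complete Hausdorff targets. The image of
`A` in the product of one representative per class is then universal
(`isReflectiveStrengthening_of_factorization`). Compactly generated spaces follow the same scheme,
with `κ` applied to subspaces of products.

For the explicit description of the bounded reflection, the translation filter of a quasi-bounded
flow is shown to be a uniformity whose flow is bounded. The identity map into this flow is a
universal arrow, so the reflection built from these arrows has the stated unit. -/

section Reflection

/-! ### Universal arrows and the solution-set argument -/

variable {D : Type*} [Category D] {P P' : ObjectProperty D}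

/-- `η : A ⟶ B` is a universal arrow from `A` to the objects satisfying `P'`. -/
def IsUniversalArrow (P' : ObjectProperty D) {A B : D} (η : A ⟶ B) : Prop :=
  P' B ∧ ∀ Y, P' Y → ∀ f : A ⟶ Y, ∃! g : B ⟶ Y, η ≫ g = f

/-- Precomposition with a universal arrow, as an equivalence of hom-sets. -/
noncomputable def IsUniversalArrow.homEquiv {A B Y : D} {η : A ⟶ B} (hη : IsUniversalArrow P' η)
    (hY : P' Y) : (B ⟶ Y) ≃ (A ⟶ Y) :=
  Equiv.ofBijective (fun g => η ≫ g)
    ⟨fun _ _ h => (hη.2 Y hY _).unique h rfl, fun f => (hη.2 Y hY f).exists⟩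

/-- A choice of universal arrows yields a reflection with these arrows as its unit. -/
theorem exists_reflective_of_universalArrow (h : P' ≤ P) (B : P.FullSubcategory → D)
    (η : ∀ A, A.obj ⟶ B A) (hη : ∀ A, IsUniversalArrow P' (η A)) :
    ∃ R : Reflective (ObjectProperty.ιOfLE h), ∀ A : P.FullSubcategory,
      ∃ e : (R.L.obj A).obj ≅ B A, (R.adj.unit.app A).hom ≫ e.hom = η A := by
  let F : P.FullSubcategory → P'.FullSubcategory := fun A => ⟨B A, (hη A).1⟩
  let E : ∀ (X : P.FullSubcategory) (Y : P'.FullSubcategory),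
      (F X ⟶ Y) ≃ (X ⟶ (ObjectProperty.ιOfLE h).obj Y) := fun X Y =>
    { toFun := fun g => ObjectProperty.homMk (η X ≫ g.hom)
      invFun := fun f => ObjectProperty.homMk (((hη X).homEquiv Y.property).symm f.hom)
      left_inv := fun g => ObjectProperty.hom_ext _
        (((hη X).homEquiv Y.property).symm_apply_apply g.hom)
      right_inv := fun f => ObjectProperty.hom_ext _
        (((hη X).homEquiv Y.property).apply_symm_apply f.hom) }
  have he : ∀ X Y Y' g k, E X Y' (k ≫ g) = E X Y k ≫ (ObjectProperty.ιOfLE h).map g := by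
    intro X Y Y' g k
    apply ObjectProperty.hom_ext
    change η X ≫ (k.hom ≫ g.hom) = (η X ≫ k.hom) ≫ g.hom
    rw [Category.assoc]
  -- The left adjoint is `F` on objects by construction, so the comparison isomorphism can be the
  -- identity; the unit is the image of the identity under `E`.
  refine ⟨{ L := Adjunction.leftAdjointOfEquiv E he
            adj := Adjunction.adjunctionOfEquivLeft E he }, fun A => ⟨Iso.refl _, ?_⟩⟩
  have : (Adjunction.adjunctionOfEquivLeft E he).unit.app A = E A (F A) (𝟙 _) := by
    simp
  dsimp only
  rw [this]
  change (η A ≫ 𝟙 (B A)) ≫ 𝟙 (B A) = η A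
  simp

theorem isReflectiveStrengthening_of_universalArrow (h : P' ≤ P)
    (H : ∀ A, P A → ∃ (B : D) (η : A ⟶ B), IsUniversalArrow P' η) :
    IsReflectiveStrengthening P P' := by
  choose B η hη using H
  obtain ⟨R, -⟩ := exists_reflective_of_universalArrow h (fun A => B A.obj A.property)
    (fun A => η A.obj A.property) (fun A => hη A.obj A.property)
  exact ⟨h, ⟨R⟩⟩

/-- If small families of morphisms into objects satisfying `P'` factor jointly through a morphism
of a class `E` of morphisms which are epimorphic with respect to `P'`, and if the morphisms in `E`
from an object to objects satisfying `P'` are classified by a small type, then `P'` cuts out a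
reflective subcategory. -/
theorem isReflectiveStrengthening_of_factorization (h : P' ≤ P)
    (E : ∀ ⦃A Z : D⦄, (A ⟶ Z) → Prop)
    (fact : ∀ (A : D) (I : Type v) (Y : I → D), (∀ i, P' (Y i)) → ∀ f : ∀ i, A ⟶ Y i,
      ∃ (Z : D) (e : A ⟶ Z), P' Z ∧ E e ∧ ∀ i, ∃ m : Z ⟶ Y i, e ≫ m = f i)
    (canc : ∀ ⦃A Z Y : D⦄ (e : A ⟶ Z), E e → P' Z → P' Y → ∀ g g' : Z ⟶ Y,
      e ≫ g = e ≫ g' → g = g')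
    (small : ∀ A : D, ∃ (T : Type v) (Φ : ∀ Z : D, (A ⟶ Z) → T),
      ∀ (Z : D) (e : A ⟶ Z) (Z' : D) (e' : A ⟶ Z'), P' Z → P' Z' → E e → E e' →
        Φ Z e = Φ Z' e' → ∃ k : Z ⟶ Z', e ≫ k = e') :
    IsReflectiveStrengthening P P' := by
  refine isReflectiveStrengthening_of_universalArrow h fun A _ => ?_
  obtain ⟨T, Φ, hΦ⟩ := small A
  -- Indexing by the attained values of `Φ` keeps the product small; one morphism is chosen for each
  -- value.
  let I : Type v := {t : T // ∃ (Z : D) (e : A ⟶ Z), P' Z ∧ E e ∧ Φ Z e = t}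
  have hI : ∀ i : I, ∃ (Z : D) (e : A ⟶ Z), P' Z ∧ E e ∧ Φ Z e = i.1 := fun i => i.2
  choose Y f hY hf hfi using hI
  obtain ⟨Z, e, hZ, he, hm⟩ := fact A I Y hY f
  refine ⟨Z, e, hZ, fun W hW g => ?_⟩
  -- Factoring `g` alone through some `e'` in `E` makes it comparable with the chosen representative
  -- of the class of `e'`, which is one of the factors covered by `e`.
  obtain ⟨Z', e', hZ', he', hm'⟩ := fact A PUnit.{v + 1} (fun _ => W) (fun _ => hW) (fun _ => g)
  obtain ⟨m', hm'⟩ := hm' PUnit.unit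
  let i : I := ⟨Φ Z' e', Z', e', hZ', he', rfl⟩
  obtain ⟨k, hk⟩ := hΦ (Y i) (f i) Z' e' (hY i) hZ' (hf i) he' (hfi i)
  obtain ⟨m, hm⟩ := hm i
  have hcomp : e ≫ m ≫ k ≫ m' = g := by
    rw [← Category.assoc, hm, ← Category.assoc, hk, hm']
  exact ⟨m ≫ k ≫ m', hcomp, fun g' hg' => canc e he hZ hW _ _ (hg'.trans hcomp.symm)⟩

end Reflection

/-! ### Flows on topological spaces -/

namespace TopFlow

variable {P : ObjectProperty TopCat.{v}} {M : Type u} [Monoid M]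

instance (A : TopFlow P M) : MulAction M A.Carrier where
  smul := A.act
  one_smul x := by
    change A.act 1 x = x
    simp [act]
  mul_smul m n x := by
    change A.act (m * n) x = A.act m (A.act n x)
    simp [act]

/-- Each translation is a morphism of `Top`, so one half of separate continuity is automatic. -/
instance (A : TopFlow P M) : ContinuousConstSMul M A.Carrier where
  continuous_const_smul m := (ConcreteCategory.hom (InducedCategory.Hom.hom (A.ρ m))).continuous

variable (P) in
/-- The flow given by a continuous monoid action on a topological space. -/
abbrev of (X : Type v) [TopologicalSpace X] [MulAction M X] [ContinuousConstSMul M X]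
    (hX : P (TopCat.of X)) : TopFlow P M where
  V := ⟨TopCat.of X, hX⟩
  ρ :=
    { toFun := fun m => ObjectProperty.homMk (TopCat.ofHom ⟨fun x => m • x, continuous_const_smul m⟩)
      map_one' := by
        apply ObjectProperty.hom_ext
        ext x
        exact one_smul M x
      map_mul' := fun m n => by
        apply ObjectProperty.hom_ext
        ext x
        exact mul_smul m n x }

/-- The function underlying a morphism of flows. -/
def mapFun {A B : TopFlow P M} (f : A ⟶ B) (x : A.Carrier) : B.Carrier :=
  ConcreteCategory.hom (InducedCategory.Hom.hom f.hom) x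

theorem continuous_mapFun {A B : TopFlow P M} (f : A ⟶ B) : Continuous (mapFun f) :=
  (ConcreteCategory.hom (InducedCategory.Hom.hom f.hom)).continuous

theorem mapFun_smul {A B : TopFlow P M} (f : A ⟶ B) (m : M) (x : A.Carrier) :
    mapFun f (m • x) = m • mapFun f x :=
  congrArg (fun k : A.V ⟶ B.V => ConcreteCategory.hom (InducedCategory.Hom.hom k) x) (f.comm m)

/-- A continuous equivariant map as a morphism of flows. -/
def homMk {A B : TopFlow P M} (f : A.Carrier → B.Carrier) (hf : Continuous f)
    (hsmul : ∀ (m : M) x, f (m • x) = m • f x) : A ⟶ B where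
  hom := ObjectProperty.homMk (TopCat.ofHom ⟨f, hf⟩)
  comm m := by
    apply ObjectProperty.hom_ext
    ext x
    exact hsmul m x

theorem mapFun_comp {A B C : TopFlow P M} (f : A ⟶ B) (g : B ⟶ C) (x : A.Carrier) :
    mapFun (f ≫ g) x = mapFun g (mapFun f x) := rfl

theorem hom_ext {A B : TopFlow P M} {f g : A ⟶ B} (h : ∀ x, mapFun f x = mapFun g x) :
    f = g := by
  apply Action.Hom.ext
  apply ObjectProperty.hom_ext
  ext x
  exact h x

end TopFlow

/-! ### Invariant images and extension of maps -/

section SubMulAction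

variable {M X Y : Type*} [Monoid M] [MulAction M X] [MulAction M Y]

/-- The range of an equivariant map. -/
abbrev SubMulAction.ofRange (f : X → Y) (hf : ∀ (m : M) x, f (m • x) = m • f x) :
    SubMulAction M Y where
  carrier := Set.range f
  smul_mem' := by
    rintro m - ⟨x, rfl⟩
    exact ⟨m • x, hf m x⟩

/-- The closure of the range of an equivariant map. -/
abbrev SubMulAction.ofClosureRange [TopologicalSpace Y] [ContinuousConstSMul M Y] (f : X → Y)
    (hf : ∀ (m : M) x, f (m • x) = m • f x) : SubMulAction M Y where
  carrier := _root_.closure (Set.range f)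
  smul_mem' := by
    intro m y hy
    exact map_mem_closure (t := Set.range f) (continuous_const_smul m) hy
      (Set.forall_mem_range.2 fun x => ⟨m • x, hf m x⟩)

theorem denseRange_codRestrict_closure {X Y : Type*} [TopologicalSpace Y] (f : X → Y) :
    DenseRange (fun x => (⟨f x, subset_closure ⟨x, rfl⟩⟩ : closure (Set.range f))) := by
  rw [DenseRange, Subtype.dense_iff]
  intro y hy
  convert hy
  ext z
  constructor
  · rintro ⟨-, ⟨x, rfl⟩, rfl⟩
    exact ⟨x, rfl⟩
  · rintro ⟨x, rfl⟩
    exact ⟨_, ⟨x, rfl⟩, rfl⟩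

instance {X : Type*} [TopologicalSpace X] [MulAction M X] [ContinuousConstSMul M X]
    (S : SubMulAction M X) : ContinuousConstSMul M S where
  continuous_const_smul m :=
    ((continuous_const_smul m).comp continuous_subtype_val).subtype_mk _

end SubMulAction

theorem exists_comp_eq_of_ker_eq {X Y Z : Type*} {e : X → Y} {e' : X → Z}
    (he : Function.Surjective e) (hker : Setoid.ker e = Setoid.ker e') :
    ∃ k : Y → Z, ∀ x, k (e x) = e' x := by
  refine ⟨e' ∘ Function.surjInv he, fun x => ?_⟩
  have : Setoid.ker e (Function.surjInv he (e x)) x := Function.surjInv_eq he (e x)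
  rw [hker] at this
  exact this

/-- For the uniformity pulled back along `e`, the map `e` is dense and uniformly inducing while `e'`
is uniformly continuous, so `e'` extends to the complete target. The `T0` axiom makes the extension
agree with `e'` exactly. -/
theorem exists_uniformContinuous_comp_eq {X Y Z : Type*} [UniformSpace Y] [UniformSpace Z]
    [CompleteSpace Z] [T0Space Z] {e : X → Y} {e' : X → Z} (he : DenseRange e)
    (h : UniformSpace.comap e inferInstance ≤ UniformSpace.comap e' inferInstance) :
    ∃ k : Y → Z, UniformContinuous k ∧ ∀ x, k (e x) = e' x := by
  let _ : UniformSpace X := UniformSpace.comap e inferInstance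
  have h1 : IsUniformInducing e := ⟨rfl⟩
  have h2 : UniformContinuous e' := uniformContinuous_iff_le_comap.2 h
  exact ⟨_, uniformContinuous_uniformly_extend h1 he h2, uniformly_extend_of_ind h1 he h2⟩

/-! ### Reflections for topological flows -/

namespace TopFlow

variable {P : ObjectProperty TopCat.{v}} {M : Type u} [Monoid M]

/-- The map from a flow to a product of flows given by a family of morphisms. -/
def piMap {A : TopFlow P M} {I : Type v} {Y : I → TopFlow P M} (f : ∀ i, A ⟶ Y i)
    (x : A.Carrier) (i : I) : (Y i).Carrier := mapFun (f i) x

theorem continuous_piMap {A : TopFlow P M} {I : Type v} {Y : I → TopFlow P M}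
    (f : ∀ i, A ⟶ Y i) : Continuous (piMap f) :=
  continuous_pi fun i => continuous_mapFun (f i)

theorem piMap_smul {A : TopFlow P M} {I : Type v} {Y : I → TopFlow P M}
    (f : ∀ i, A ⟶ Y i) (m : M) (x : A.Carrier) : piMap f (m • x) = m • piMap f x :=
  funext fun i => mapFun_smul (f i) m x

theorem comp_cancel_of_surjective {A Z Y : TopFlow P M} (e : A ⟶ Z)
    (he : Function.Surjective (mapFun e)) (g g' : Z ⟶ Y) (h : e ≫ g = e ≫ g') : g = g' :=
  hom_ext <| he.forall.2 fun x => by rw [← mapFun_comp, h, mapFun_comp]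

theorem comp_cancel_of_denseRange {A Z Y : TopFlow P M} (e : A ⟶ Z) (he : DenseRange (mapFun e))
    [T2Space Y.Carrier] (g g' : Z ⟶ Y) (h : e ≫ g = e ≫ g') : g = g' := by
  refine hom_ext (congrFun (he.equalizer (continuous_mapFun g) (continuous_mapFun g') ?_))
  ext x
  exact congrArg (fun k => mapFun k x) h

/-- Equal kernels give the map `k`. An open set of `Z'` pulls back to `A` as the preimage of some
open `U` in `Z`, and surjectivity of `e` forces `U` to be its preimage under `k`. -/
theorem exists_comp_eq_of_surjective {A Z Z' : TopFlow P M} (e : A ⟶ Z) (e' : A ⟶ Z')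
    (he : Function.Surjective (mapFun e))
    (hker : Setoid.ker (mapFun e) = Setoid.ker (mapFun e'))
    (htop : TopologicalSpace.induced (mapFun e) inferInstance =
      TopologicalSpace.induced (mapFun e') inferInstance) :
    ∃ k : Z ⟶ Z', e ≫ k = e' := by
  obtain ⟨k, hk⟩ := exists_comp_eq_of_ker_eq he hker
  refine ⟨homMk k ?_ fun m => he.forall.2 fun x => ?_, hom_ext fun x => hk x⟩
  · refine continuous_def.2 fun V hV => ?_
    have hV' : @IsOpen _ (TopologicalSpace.induced (mapFun e') inferInstance)
        (mapFun e' ⁻¹' V) := ⟨V, hV, rfl⟩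
    rw [← htop] at hV'
    obtain ⟨U, hU, hUV⟩ := hV'
    convert hU
    ext y
    obtain ⟨x, rfl⟩ := he y
    have := Set.ext_iff.1 hUV x
    simp only [Set.mem_preimage] at this ⊢
    rw [hk, this]
  · rw [← mapFun_smul, hk, hk, mapFun_smul]

/-- A compact Hausdorff space is complete for its unique compatible uniformity, so the extension
theorem applies, and density gives equivariance. The induced topology would not be enough: it does
not tell apart different compactifications. -/
theorem exists_comp_eq_of_denseRange {A Z Z' : TopFlow P M} (e : A ⟶ Z) (e' : A ⟶ Z')
    (he : DenseRange (mapFun e)) [CompactSpace Z.Carrier] [T2Space Z.Carrier]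
    [CompactSpace Z'.Carrier] [T2Space Z'.Carrier]
    (h : (uniformSpaceOfCompactR1 (γ := Z.Carrier)).comap (mapFun e) =
      (uniformSpaceOfCompactR1 (γ := Z'.Carrier)).comap (mapFun e')) :
    ∃ k : Z ⟶ Z', e ≫ k = e' := by
  let _ := uniformSpaceOfCompactR1 (γ := Z.Carrier)
  let _ := uniformSpaceOfCompactR1 (γ := Z'.Carrier)
  obtain ⟨k, hk', hke⟩ := exists_uniformContinuous_comp_eq he h.le
  have hk := hk'.continuous
  refine ⟨homMk k hk fun m => congrFun (he.equalizer (hk.comp (continuous_const_smul m))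
    ((continuous_const_smul m).comp hk) ?_), hom_ext fun x => hke x⟩
  ext x
  simp only [Function.comp_apply]
  rw [← mapFun_smul, hke, hke, mapFun_smul]

section Constraint

variable [TopologicalSpace M] {𝒮 𝒥 𝒮' 𝒥' : Set (Set M)}

theorem constraint_le (hS : FamilyEnlarges 𝒮 𝒮') (hJ : FamilyEnlarges 𝒥 𝒥') :
    (Constraint 𝒮' 𝒥' : ObjectProperty (TopFlow P M)) ≤ Constraint 𝒮 𝒥 := by
  refine fun A hA => ⟨fun S h => ?_, fun J h => ?_⟩
  · obtain ⟨S', h', hSS'⟩ := hS S h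
    exact ⟨fun s => continuous_const_smul s.1,
      fun x => ((hA.1 S' h').2 x).comp (continuous_inclusion hSS')⟩
  · obtain ⟨J', h', hJJ'⟩ := hJ J h
    exact (hA.2 J' h').comp ((continuous_inclusion hJJ').prodMap continuous_id)

/-- Continuity into an initial topology is tested after each `m i`, and equivariance rewrites the
result as the action on `Y i` precomposed with `m i` in the space variable. -/
theorem Constraint.of_isInducing {A : TopFlow P M} {I : Type v} {Y : I → TopFlow P M}
    (m : ∀ i, A ⟶ Y i) (hm : IsInducing (piMap m)) (hY : ∀ i, Constraint 𝒮 𝒥 (Y i)) :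
    Constraint 𝒮 𝒥 A := by
  refine ⟨fun S h => ⟨fun s => continuous_const_smul s.1, fun x => ?_⟩, fun J h => ?_⟩
  · rw [hm.continuous_iff, continuous_pi_iff]
    intro i
    convert ((hY i).1 S h).2 (mapFun (m i) x) using 2 with s
    exact mapFun_smul (m i) s.1 x
  · rw [hm.continuous_iff, continuous_pi_iff]
    intro i
    convert ((hY i).2 J h).comp (continuous_id.prodMap (continuous_mapFun (m i))) using 2 with p
    exact mapFun_smul (m i) p.1.1 p.2

theorem Constraint.of_subMulAction {I : Type v} {Y : I → TopFlow P M}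
    (hY : ∀ i, Constraint 𝒮 𝒥 (Y i)) (S : SubMulAction M (∀ i, (Y i).Carrier))
    (hS : P (TopCat.of S)) : Constraint 𝒮 𝒥 (of P S hS) :=
  Constraint.of_isInducing (A := of P S hS)
    (fun i => homMk (fun z : S => z.1 i) ((continuous_apply i).comp continuous_subtype_val)
      fun _ _ => rfl) IsInducing.subtypeVal hY

/-- The class `E` consists of the surjective morphisms; the factoring object is the image in the
product with the subspace topology. -/
theorem isReflectiveStrengthening_of_hereditary
    (hP : ∀ (I : Type v) (Y : I → TopCat.{v}), (∀ i, P (Y i)) → ∀ S : Set (∀ i, Y i),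
      P (TopCat.of S))
    (hS : FamilyEnlarges 𝒮 𝒮') (hJ : FamilyEnlarges 𝒥 𝒥') :
    IsReflectiveStrengthening (Constraint 𝒮 𝒥 : ObjectProperty (TopFlow P M))
      (Constraint 𝒮' 𝒥') := by
  refine isReflectiveStrengthening_of_factorization.{v} (constraint_le hS hJ)
    (fun _ _ e => Function.Surjective (mapFun e)) ?_
    (fun _ _ _ e he _ _ => comp_cancel_of_surjective e he) ?_
  · intro A I Y hY f
    let S := SubMulAction.ofRange (piMap f) (piMap_smul f)
    have hS : P (TopCat.of S) := hP I (fun i => (Y i).V.obj) (fun i => (Y i).V.property) S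
    refine ⟨of P S hS, homMk (fun x => (⟨piMap f x, x, rfl⟩ : S))
      ((continuous_piMap f).subtype_mk _) (fun m x => Subtype.ext (piMap_smul f m x)),
      Constraint.of_subMulAction hY S hS, ?_, fun i =>
      ⟨homMk (fun z : S => z.1 i) ((continuous_apply i).comp continuous_subtype_val)
        fun _ _ => rfl, rfl⟩⟩
    rintro ⟨-, x, rfl⟩
    exact ⟨x, rfl⟩
  · exact fun A => ⟨Setoid A.Carrier × TopologicalSpace A.Carrier, fun Z e =>
      (Setoid.ker (mapFun e), TopologicalSpace.induced (mapFun e) inferInstance),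
      fun Z e Z' e' _ _ he _ h => exists_comp_eq_of_surjective e e' he
        (congrArg Prod.fst h) (congrArg Prod.snd h)⟩

/-- Images need not be compact, so `E` consists of the morphisms with dense range and the factoring
object is the closure of the image in the compact product. -/
theorem isReflectiveStrengthening_of_compactT2
    (hS : FamilyEnlarges 𝒮 𝒮') (hJ : FamilyEnlarges 𝒥 𝒥') :
    IsReflectiveStrengthening
      (Constraint 𝒮 𝒥 : ObjectProperty (TopFlow (TopKind.prop.{v} .compactT2) M))
      (Constraint 𝒮' 𝒥') := by
  have hc : ∀ A : TopFlow (TopKind.prop.{v} .compactT2) M, CompactSpace A.Carrier :=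
    fun A => A.V.property.1
  have ht : ∀ A : TopFlow (TopKind.prop.{v} .compactT2) M, T2Space A.Carrier :=
    fun A => A.V.property.2
  refine isReflectiveStrengthening_of_factorization.{v} (constraint_le hS hJ)
    (fun _ _ e => DenseRange (mapFun e)) ?_
    (fun _ _ _ e he _ _ => comp_cancel_of_denseRange e he) ?_
  · intro A I Y hY f
    let S := SubMulAction.ofClosureRange (piMap f) (piMap_smul f)
    have hS : TopKind.prop.{v} .compactT2 (TopCat.of S) :=
      ⟨isCompact_iff_compactSpace.1
        (isClosed_closure (s := Set.range (piMap f))).isCompact,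
        inferInstanceAs (T2Space (closure (Set.range (piMap f))))⟩
    exact ⟨of _ S hS, homMk (fun x => (⟨piMap f x, subset_closure ⟨x, rfl⟩⟩ : S))
      ((continuous_piMap f).subtype_mk _) (fun m x => Subtype.ext (piMap_smul f m x)),
      Constraint.of_subMulAction hY S hS, denseRange_codRestrict_closure (piMap f), fun i =>
      ⟨homMk (fun z : S => z.1 i) ((continuous_apply i).comp continuous_subtype_val)
        fun _ _ => rfl, rfl⟩⟩
  · exact fun A => ⟨UniformSpace A.Carrier,
      fun Z e => (uniformSpaceOfCompactR1 (γ := Z.Carrier)).comap (mapFun e),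
      fun Z e Z' e' _ _ he _ h => exists_comp_eq_of_denseRange e e' he h⟩

theorem isReflectiveStrengthening_constraint (c : TopKind)
    (hS : FamilyEnlarges 𝒮 𝒮') (hJ : FamilyEnlarges 𝒥 𝒥') :
    IsReflectiveStrengthening
      (Constraint 𝒮 𝒥 : ObjectProperty (TopFlow (TopKind.prop.{v} c) M))
      (Constraint 𝒮' 𝒥') := by
  cases c with
  | compactT2 => exact isReflectiveStrengthening_of_compactT2 hS hJ
  | blank => exact isReflectiveStrengthening_of_hereditary (fun _ _ _ _ => trivial) hS hJ
  | T0 =>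
    refine isReflectiveStrengthening_of_hereditary (fun I Y hY S => ?_) hS hJ
    have : ∀ i, T0Space (Y i) := hY
    exact inferInstanceAs (T0Space S)
  | T1 =>
    refine isReflectiveStrengthening_of_hereditary (fun I Y hY S => ?_) hS hJ
    have : ∀ i, T1Space (Y i) := hY
    exact inferInstanceAs (T1Space S)
  | T2 =>
    refine isReflectiveStrengthening_of_hereditary (fun I Y hY S => ?_) hS hJ
    have : ∀ i, T2Space (Y i) := hY
    exact inferInstanceAs (T2Space S)
  | T2f =>
    refine isReflectiveStrengthening_of_hereditary (fun I Y hY S => ?_) hS hJ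
    intro x y hxy
    obtain ⟨i, hi⟩ := Function.ne_iff.1 (Subtype.coe_injective.ne hxy)
    obtain ⟨f, hf, hne⟩ := hY i _ _ hi
    exact ⟨fun z : S => f (z.1 i),
      hf.comp ((continuous_apply i).comp continuous_subtype_val), hne⟩
  | Tychonoff =>
    refine isReflectiveStrengthening_of_hereditary (fun I Y hY S => ?_) hS hJ
    have : ∀ i, T35Space (Y i) := hY
    exact inferInstanceAs (T35Space S)

end Constraint

end TopFlow

/-! ### Compactly generated spaces -/

namespace CompactCoherentification

/-- This is the universal property of the coreflection: apply `κ` to the map and use that `W` agrees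
with its own coherentification. -/
theorem continuous_of_comp_symm {W X : Type*} [TopologicalSpace W] [CompactlyCoherentSpace W]
    [TopologicalSpace X] {f : W → CompactCoherentification X}
    (hf : Continuous ((CompactCoherentification.mk X).symm ∘ f)) : Continuous f :=
  (continuous_map_of_continuous hf).comp continuous_mk

theorem continuous_of_forall_apply {W ι : Type*} {Y : ι → Type*} [TopologicalSpace W]
    [CompactlyCoherentSpace W] [∀ i, TopologicalSpace (Y i)] {p : (∀ i, Y i) → Prop}
    {f : W → CompactCoherentification (Subtype p)}
    (hf : ∀ i, Continuous fun w => ((CompactCoherentification.mk _).symm (f w)).1 i) :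
    Continuous f :=
  continuous_of_comp_symm (IsInducing.subtypeVal.continuous_iff.2 (continuous_pi hf))

theorem continuous_map_prod {W W' X X' : Type*} [TopologicalSpace W] [TopologicalSpace W']
    [TopologicalSpace X] [TopologicalSpace X'] {f : W → W'} {g : X → X'}
    (hf : Continuous f) (hg : Continuous g) :
    Continuous (CompactCoherentification.map
      (Prod.map (CompactCoherentification.map f) g)) :=
  continuous_map_of_continuous ((continuous_map_of_continuous hf).prodMap hg)

instance {M X : Type*} [Monoid M] [h : MulAction M X] :
    MulAction M (CompactCoherentification X) := h

instance {M X : Type*} [Monoid M] [MulAction M X] [TopologicalSpace X] [ContinuousConstSMul M X] :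
    ContinuousConstSMul M (CompactCoherentification X) where
  continuous_const_smul m :=
    continuous_of_comp_symm ((continuous_const_smul m).comp continuous_mk_symm)

end CompactCoherentification

namespace TopFlow

section KConstraint

variable {P : ObjectProperty TopCat.{v}} {M : Type u} [Monoid M] [TopologicalSpace M]
  {𝒮 𝒥 𝒮' 𝒥' : Set (Set M)}

theorem kConstraint_le (hS : FamilyEnlarges 𝒮 𝒮') (hJ : FamilyEnlarges 𝒥 𝒥') :
    (KConstraint 𝒮' 𝒥' : ObjectProperty (TopFlow P M)) ≤ KConstraint 𝒮 𝒥 := by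
  refine fun A hA => ⟨fun S h => ?_, fun J h => ?_⟩
  · obtain ⟨S', h', hSS'⟩ := hS S h
    exact ⟨fun s => continuous_const_smul s.1, fun x => ((hA.1 S' h').2 x).comp
      (CompactCoherentification.continuous_map_of_continuous (continuous_inclusion hSS'))⟩
  · obtain ⟨J', h', hJJ'⟩ := hJ J h
    exact (hA.2 J' h').comp
      (CompactCoherentification.continuous_map_prod (continuous_inclusion hJJ') continuous_id)

/-- The orbit and joint action maps start from coherentifications, which are compactly generated.
Hence their continuity into `κ(S)` is tested on coordinates, although `κ(S)` need not carry the
initial topology. -/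
theorem KConstraint.of_subMulAction {I : Type v} {Y : I → TopFlow P M}
    (hY : ∀ i, KConstraint 𝒮 𝒥 (Y i)) (S : SubMulAction M (∀ i, (Y i).Carrier))
    (hS : P (TopCat.of (CompactCoherentification S))) :
    KConstraint 𝒮 𝒥 (of P (CompactCoherentification S) hS) := by
  refine ⟨fun T h => ⟨fun s => continuous_const_smul s.1, fun x => ?_⟩, fun J h => ?_⟩
  · exact CompactCoherentification.continuous_of_forall_apply fun i =>
      ((hY i).1 T h).2 (((CompactCoherentification.mk S).symm x).1 i)
  · refine CompactCoherentification.continuous_of_forall_apply fun i => ?_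
    have hp : Continuous fun z : CompactCoherentification S =>
        ((CompactCoherentification.mk S).symm z).1 i :=
      ((continuous_apply i).comp continuous_subtype_val).comp
        CompactCoherentification.continuous_mk_symm
    exact ((hY i).2 J h).comp
      (CompactCoherentification.continuous_map_prod (continuous_id (X := J)) hp)

theorem isReflectiveStrengthening_kConstraint_of_hereditary
    (hk : ∀ X, P X → CompactlyCoherentSpace X)
    (hP : ∀ (I : Type v) (Y : I → TopCat.{v}), (∀ i, P (Y i)) → ∀ S : Set (∀ i, Y i),
      P (TopCat.of (CompactCoherentification S)))
    (hS : FamilyEnlarges 𝒮 𝒮') (hJ : FamilyEnlarges 𝒥 𝒥') :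
    IsReflectiveStrengthening (KConstraint 𝒮 𝒥 : ObjectProperty (TopFlow P M))
      (KConstraint 𝒮' 𝒥') := by
  refine isReflectiveStrengthening_of_factorization.{v} (kConstraint_le hS hJ)
    (fun _ _ e => Function.Surjective (mapFun e)) ?_
    (fun _ _ _ e he _ _ => comp_cancel_of_surjective e he) ?_
  · intro A I Y hY f
    let S := SubMulAction.ofRange (piMap f) (piMap_smul f)
    have hS : P (TopCat.of (CompactCoherentification S)) :=
      hP I (fun i => (Y i).V.obj) (fun i => (Y i).V.property) S
    -- This lets the continuous map from `A` to `S` lift to the finer topology of `κ(S)`.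
    have : CompactlyCoherentSpace A.Carrier := hk _ A.V.property
    let e : A ⟶ of P (CompactCoherentification S) hS :=
      homMk (fun x => CompactCoherentification.mk S (⟨piMap f x, x, rfl⟩ : S))
        (CompactCoherentification.continuous_of_comp_symm ((continuous_piMap f).subtype_mk _))
        (fun m x => Subtype.ext (piMap_smul f m x))
    let p : ∀ i, of P (CompactCoherentification S) hS ⟶ Y i := fun i =>
      homMk (fun z => ((CompactCoherentification.mk S).symm z).1 i)
        (((continuous_apply i).comp continuous_subtype_val).comp
          CompactCoherentification.continuous_mk_symm) fun _ _ => rfl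
    refine ⟨_, e, KConstraint.of_subMulAction hY S hS, ?_, fun i => ⟨p i, rfl⟩⟩
    rintro ⟨-, x, rfl⟩
    exact ⟨x, rfl⟩
  · exact fun A => ⟨Setoid A.Carrier × TopologicalSpace A.Carrier, fun Z e =>
      (Setoid.ker (mapFun e), TopologicalSpace.induced (mapFun e) inferInstance),
      fun Z e Z' e' _ _ he _ h => exists_comp_eq_of_surjective e e' he
        (congrArg Prod.fst h) (congrArg Prod.snd h)⟩

theorem isReflectiveStrengthening_kConstraint (c : KTopKind)
    (hS : FamilyEnlarges 𝒮 𝒮') (hJ : FamilyEnlarges 𝒥 𝒥') :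
    IsReflectiveStrengthening
      (KConstraint 𝒮 𝒥 : ObjectProperty (TopFlow (KTopKind.prop.{v} c) M))
      (KConstraint 𝒮' 𝒥') := by
  cases c with
  | blank =>
    exact isReflectiveStrengthening_kConstraint_of_hereditary (fun _ h => h)
      (fun _ _ _ S => inferInstanceAs (CompactlyCoherentSpace (CompactCoherentification S))) hS hJ
  | T2 =>
    refine isReflectiveStrengthening_kConstraint_of_hereditary (fun _ h => h.1)
      (fun I Y hY S => ?_) hS hJ
    have : ∀ i, T2Space (Y i) := fun i => (hY i).2
    exact ⟨inferInstanceAs (CompactlyCoherentSpace (CompactCoherentification S)),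
      inferInstanceAs (T2Space (CompactCoherentification S))⟩

end KConstraint

end TopFlow

/-! ### Flows on uniform spaces -/

namespace UnifFlow

variable {P : ObjectProperty UniformSpaceCat.{v}}

section Monoid

variable {M : Type u} [Monoid M]

instance (A : UnifFlow P M) : MulAction M A.Carrier where
  smul := A.act
  one_smul x := by
    change A.act 1 x = x
    simp [act]
    rfl
  mul_smul m n x := by
    change A.act (m * n) x = A.act m (A.act n x)
    simp [act]
    rfl

instance (A : UnifFlow P M) : UniformContinuousConstSMul M A.Carrier where
  uniformContinuous_const_smul m :=
    (ConcreteCategory.hom (InducedCategory.Hom.hom (A.ρ m))).2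

variable (P) in
/-- The flow given by a monoid action on a uniform space by uniformly continuous maps. -/
abbrev of (X : Type v) [UniformSpace X] [MulAction M X] [UniformContinuousConstSMul M X]
    (hX : P (UniformSpaceCat.of X)) : UnifFlow P M where
  V := ⟨UniformSpaceCat.of X, hX⟩
  ρ :=
    { toFun := fun m => ObjectProperty.homMk
        (UniformSpaceCat.ofHom ⟨fun x => m • x, uniformContinuous_const_smul m⟩)
      map_one' := by
        apply ObjectProperty.hom_ext
        ext x
        exact one_smul M x
      map_mul' := fun m n => by
        apply ObjectProperty.hom_ext
        ext x
        exact mul_smul m n x }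

theorem uniformContinuous_mapFun {A B : UnifFlow P M} (f : A ⟶ B) :
    UniformContinuous (mapFun f) :=
  (ConcreteCategory.hom (InducedCategory.Hom.hom f.hom)).2

theorem mapFun_smul {A B : UnifFlow P M} (f : A ⟶ B) (m : M) (x : A.Carrier) :
    mapFun f (m • x) = m • mapFun f x :=
  congrArg (fun k : A.V ⟶ B.V => ConcreteCategory.hom (InducedCategory.Hom.hom k) x) (f.comm m)

/-- A uniformly continuous equivariant map as a morphism of flows. -/
def homMk {A B : UnifFlow P M} (f : A.Carrier → B.Carrier) (hf : UniformContinuous f)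
    (hsmul : ∀ (m : M) x, f (m • x) = m • f x) : A ⟶ B where
  hom := ObjectProperty.homMk (UniformSpaceCat.ofHom ⟨f, hf⟩)
  comm m := by
    apply ObjectProperty.hom_ext
    ext x
    exact hsmul m x

theorem mapFun_comp {A B C : UnifFlow P M} (f : A ⟶ B) (g : B ⟶ C) (x : A.Carrier) :
    mapFun (f ≫ g) x = mapFun g (mapFun f x) := rfl

theorem hom_ext {A B : UnifFlow P M} {f g : A ⟶ B} (h : ∀ x, mapFun f x = mapFun g x) :
    f = g := by
  apply Action.Hom.ext
  apply ObjectProperty.hom_ext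
  ext x
  exact h x

/-- The map from a flow to a product of flows given by a family of morphisms. -/
def piMap {A : UnifFlow P M} {I : Type v} {Y : I → UnifFlow P M} (f : ∀ i, A ⟶ Y i)
    (x : A.Carrier) (i : I) : (Y i).Carrier := mapFun (f i) x

theorem uniformContinuous_piMap {A : UnifFlow P M} {I : Type v} {Y : I → UnifFlow P M}
    (f : ∀ i, A ⟶ Y i) : UniformContinuous (piMap f) :=
  uniformContinuous_pi.2 fun i => uniformContinuous_mapFun (f i)

theorem piMap_smul {A : UnifFlow P M} {I : Type v} {Y : I → UnifFlow P M}
    (f : ∀ i, A ⟶ Y i) (m : M) (x : A.Carrier) : piMap f (m • x) = m • piMap f x :=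
  funext fun i => mapFun_smul (f i) m x

theorem comp_cancel_of_surjective {A Z Y : UnifFlow P M} (e : A ⟶ Z)
    (he : Function.Surjective (mapFun e)) (g g' : Z ⟶ Y) (h : e ≫ g = e ≫ g') : g = g' :=
  hom_ext <| he.forall.2 fun x => by rw [← mapFun_comp, h, mapFun_comp]

theorem comp_cancel_of_denseRange {A Z Y : UnifFlow P M} (e : A ⟶ Z) (he : DenseRange (mapFun e))
    [T2Space Y.Carrier] (g g' : Z ⟶ Y) (h : e ≫ g = e ≫ g') : g = g' := by
  refine hom_ext (congrFun (he.equalizer (uniformContinuous_mapFun g).continuous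
    (uniformContinuous_mapFun g').continuous ?_))
  ext x
  exact congrArg (fun k => mapFun k x) h

theorem exists_comp_eq_of_surjective {A Z Z' : UnifFlow P M} (e : A ⟶ Z) (e' : A ⟶ Z')
    (he : Function.Surjective (mapFun e))
    (hker : Setoid.ker (mapFun e) = Setoid.ker (mapFun e'))
    (hunif : UniformSpace.comap (mapFun e) inferInstance =
      UniformSpace.comap (mapFun e') inferInstance) :
    ∃ k : Z ⟶ Z', e ≫ k = e' := by
  obtain ⟨k, hk⟩ := exists_comp_eq_of_ker_eq he hker
  refine ⟨homMk k ?_ fun m => he.forall.2 fun x => ?_, hom_ext fun x => hk x⟩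
  · have hcomap : Filter.comap (Prod.map (mapFun e) (mapFun e)) (𝓤 Z.Carrier) =
        Filter.comap (Prod.map (mapFun e') (mapFun e')) (𝓤 Z'.Carrier) :=
      congrArg (fun t : UniformSpace A.Carrier => 𝓤[t]) hunif
    have hcomp : Prod.map k k ∘ Prod.map (mapFun e) (mapFun e) =
        Prod.map (mapFun e') (mapFun e') :=
      funext fun p => Prod.ext (hk p.1) (hk p.2)
    change Filter.map (Prod.map k k) (𝓤 Z.Carrier) ≤ 𝓤 Z'.Carrier
    -- Surjectivity makes `𝓤 Z.Carrier` the pushforward of its pullback to `A`; pushing on along `k`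
    -- is then pushing forward along `e'`.
    rw [← Filter.map_comap_of_surjective (he.prodMap he) (𝓤 Z.Carrier), Filter.map_map, hcomp,
      hcomap]
    exact Filter.map_comap_le
  · rw [← mapFun_smul, hk, hk, mapFun_smul]

theorem exists_comp_eq_of_denseRange {A Z Z' : UnifFlow P M} (e : A ⟶ Z) (e' : A ⟶ Z')
    (he : DenseRange (mapFun e)) [CompleteSpace Z'.Carrier] [T2Space Z'.Carrier]
    (h : UniformSpace.comap (mapFun e) inferInstance =
      UniformSpace.comap (mapFun e') inferInstance) :
    ∃ k : Z ⟶ Z', e ≫ k = e' := by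
  obtain ⟨k, hk, hke⟩ := exists_uniformContinuous_comp_eq he h.le
  refine ⟨homMk k hk fun m => congrFun
    (he.equalizer (hk.continuous.comp (continuous_const_smul m))
      ((continuous_const_smul m).comp hk.continuous) ?_), hom_ext fun x => hke x⟩
  ext x
  simp only [Function.comp_apply]
  rw [← mapFun_smul, hke, hke, mapFun_smul]

/-- A property of flows is initially closed if it is inherited by flows carrying the initial
uniformity with respect to a family of morphisms to flows having the property. -/
def InitiallyClosed (Q : ObjectProperty (UnifFlow P M)) : Prop :=
  ∀ ⦃A : UnifFlow P M⦄ ⦃I : Type v⦄ ⦃Y : I → UnifFlow P M⦄ (m : ∀ i, A ⟶ Y i),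
    IsUniformInducing (piMap m) → (∀ i, Q (Y i)) → Q A

instance {X : Type*} [UniformSpace X] [MulAction M X] [UniformContinuousConstSMul M X]
    (S : SubMulAction M X) : UniformContinuousConstSMul M S where
  uniformContinuous_const_smul m :=
    ((uniformContinuous_const_smul m).comp uniformContinuous_subtype_val).subtype_mk _

instance {I : Type*} {X : I → Type*} [∀ i, UniformSpace (X i)] [∀ i, MulAction M (X i)]
    [∀ i, UniformContinuousConstSMul M (X i)] : UniformContinuousConstSMul M (∀ i, X i) where
  uniformContinuous_const_smul m := uniformContinuous_pi.2 fun i =>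
    (uniformContinuous_const_smul m).comp (Pi.uniformContinuous_proj _ i)

variable {Q Q' : ObjectProperty (UnifFlow P M)}

theorem InitiallyClosed.of_subMulAction (hQ : InitiallyClosed Q) {I : Type v}
    {Y : I → UnifFlow P M} (hY : ∀ i, Q (Y i)) (S : SubMulAction M (∀ i, (Y i).Carrier))
    (hS : P (UniformSpaceCat.of S)) : Q (of P S hS) :=
  hQ (A := of P S hS)
    (fun i => homMk (fun z : S => z.1 i)
      ((Pi.uniformContinuous_proj _ i).comp uniformContinuous_subtype_val)
      fun _ _ => rfl)
    -- The `piMap` of the coordinate projections is the inclusion of `S`, whose uniformity is a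
    -- pullback by definition.
    (⟨rfl⟩ : IsUniformInducing fun z : S => z.1) hY

theorem isReflectiveStrengthening_of_hereditary
    (hP : ∀ (I : Type v) (Y : I → UniformSpaceCat.{v}), (∀ i, P (Y i)) → ∀ S : Set (∀ i, Y i),
      P (UniformSpaceCat.of S))
    (h : Q' ≤ Q) (hQ' : InitiallyClosed Q') : IsReflectiveStrengthening Q Q' := by
  refine isReflectiveStrengthening_of_factorization.{v} h
    (fun _ _ e => Function.Surjective (mapFun e)) ?_
    (fun _ _ _ e he _ _ => comp_cancel_of_surjective e he) ?_
  · intro A I Y hY f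
    let S := SubMulAction.ofRange (piMap f) (piMap_smul f)
    have hS : P (UniformSpaceCat.of S) :=
      hP I (fun i => (Y i).V.obj) (fun i => (Y i).V.property) S
    refine ⟨of P S hS, homMk (fun x => (⟨piMap f x, x, rfl⟩ : S))
      ((uniformContinuous_piMap f).subtype_mk _) (fun m x => Subtype.ext (piMap_smul f m x)),
      hQ'.of_subMulAction hY S hS, ?_, fun i =>
      ⟨homMk (fun z : S => z.1 i)
        ((Pi.uniformContinuous_proj _ i).comp uniformContinuous_subtype_val)
        fun _ _ => rfl, rfl⟩⟩
    rintro ⟨-, x, rfl⟩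
    exact ⟨x, rfl⟩
  · exact fun A => ⟨Setoid A.Carrier × UniformSpace A.Carrier, fun Z e =>
      (Setoid.ker (mapFun e), UniformSpace.comap (mapFun e) inferInstance),
      fun Z e Z' e' _ _ he _ h => exists_comp_eq_of_surjective e e' he
        (congrArg Prod.fst h) (congrArg Prod.snd h)⟩

theorem isReflectiveStrengthening_of_completeT2
    {Q Q' : ObjectProperty (UnifFlow (UnifKind.prop.{v} .completeT2) M)}
    (h : Q' ≤ Q) (hQ' : InitiallyClosed Q') : IsReflectiveStrengthening Q Q' := by
  have hc : ∀ A : UnifFlow (UnifKind.prop.{v} .completeT2) M, CompleteSpace A.Carrier :=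
    fun A => A.V.property.2
  have ht : ∀ A : UnifFlow (UnifKind.prop.{v} .completeT2) M, T2Space A.Carrier :=
    fun A => A.V.property.1
  refine isReflectiveStrengthening_of_factorization.{v} h
    (fun _ _ e => DenseRange (mapFun e)) ?_
    (fun _ _ _ e he _ _ => comp_cancel_of_denseRange e he) ?_
  · intro A I Y hY f
    let S := SubMulAction.ofClosureRange (piMap f) (piMap_smul f)
    have hS : UnifKind.prop.{v} .completeT2 (UniformSpaceCat.of S) :=
      ⟨inferInstanceAs (T2Space (closure (Set.range (piMap f)))),
        (isClosed_closure (s := Set.range (piMap f))).completeSpace_coe⟩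
    exact ⟨of _ S hS, homMk (fun x => (⟨piMap f x, subset_closure ⟨x, rfl⟩⟩ : S))
      ((uniformContinuous_piMap f).subtype_mk _) (fun m x => Subtype.ext (piMap_smul f m x)),
      hQ'.of_subMulAction hY S hS, denseRange_codRestrict_closure (piMap f), fun i =>
      ⟨homMk (fun z : S => z.1 i)
        ((Pi.uniformContinuous_proj _ i).comp uniformContinuous_subtype_val)
        fun _ _ => rfl, rfl⟩⟩
  · exact fun A => ⟨UniformSpace A.Carrier,
      fun Z e => UniformSpace.comap (mapFun e) inferInstance,
      fun Z e Z' e' _ _ he _ h => exists_comp_eq_of_denseRange e e' he h⟩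

/-- This reduces reflectivity of every uniform condition to two checks, the implication `Q' ≤ Q` and
initial closure of `Q'`; nothing else about `Q` matters. -/
theorem isReflectiveStrengthening_of_initiallyClosed {c : UnifKind}
    {Q Q' : ObjectProperty (UnifFlow (UnifKind.prop.{v} c) M)}
    (h : Q' ≤ Q) (hQ' : InitiallyClosed Q') : IsReflectiveStrengthening Q Q' := by
  cases c with
  | blank => exact isReflectiveStrengthening_of_hereditary (fun _ _ _ _ => trivial) h hQ'
  | T2 =>
    refine isReflectiveStrengthening_of_hereditary (fun I Y hY S => ?_) h hQ'
    have : ∀ i, T2Space (Y i) := hY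
    exact inferInstanceAs (T2Space S)
  | completeT2 => exact isReflectiveStrengthening_of_completeT2 h hQ'

theorem initiallyClosed_jointlyUniform (𝒰 : UniformSpace M) :
    InitiallyClosed (JointlyUniform 𝒰 : ObjectProperty (UnifFlow P M)) := by
  intro A I Y m hm hY
  rw [JointlyUniform, hm.uniformContinuous_iff, uniformContinuous_pi]
  intro i
  convert (hY i).comp (uniformContinuous_id.prodMap (uniformContinuous_mapFun (m i)))
    using 2 with p
  exact mapFun_smul (m i) p.1 p.2

section Constraint

variable [UniformSpace M] {𝒮 𝒥 𝒮' 𝒥' : Set (Set M)}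

theorem uniformContinuous_inclusion {X : Type*} [UniformSpace X] {S T : Set X} (h : S ⊆ T) :
    UniformContinuous (Set.inclusion h) :=
  uniformContinuous_subtype_val.subtype_mk _

theorem constraint_le (hS : FamilyEnlarges 𝒮 𝒮') (hJ : FamilyEnlarges 𝒥 𝒥') :
    (Constraint 𝒮' 𝒥' : ObjectProperty (UnifFlow P M)) ≤ Constraint 𝒮 𝒥 := by
  refine fun A hA => ⟨fun S h => ?_, fun J h => ?_⟩
  · obtain ⟨S', h', hSS'⟩ := hS S h
    exact ⟨fun s => uniformContinuous_const_smul s.1,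
      fun x => ((hA.1 S' h').2 x).comp (uniformContinuous_inclusion hSS')⟩
  · obtain ⟨J', h', hJJ'⟩ := hJ J h
    exact (hA.2 J' h').comp ((uniformContinuous_inclusion hJJ').prodMap uniformContinuous_id)

theorem initiallyClosed_constraint :
    InitiallyClosed (Constraint 𝒮 𝒥 : ObjectProperty (UnifFlow P M)) := by
  intro A I Y m hm hY
  refine ⟨fun S h => ⟨fun s => uniformContinuous_const_smul s.1, fun x => ?_⟩, fun J h => ?_⟩
  · rw [hm.uniformContinuous_iff, uniformContinuous_pi]
    intro i
    convert ((hY i).1 S h).2 (mapFun (m i) x) using 2 with s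
    exact mapFun_smul (m i) s.1 x
  · rw [hm.uniformContinuous_iff, uniformContinuous_pi]
    intro i
    convert ((hY i).2 J h).comp
      (uniformContinuous_id.prodMap (uniformContinuous_mapFun (m i))) using 2 with p
    exact mapFun_smul (m i) p.1.1 p.2

end Constraint

end Monoid

/-! ### Boundedness conditions for group flows -/

section Group

variable {G : Type u} [Group G] [TopologicalSpace G]

/-- The factor `⊤` encodes uniformity in the point. In this form boundedness can be tested through
infima and pullbacks of uniformities. -/
theorem bounded_iff_tendsto (A : UnifFlow P G) :
    Bounded A ↔ Filter.Tendsto (fun p : G × A.Carrier => (p.1 • p.2, p.2)) (𝓝 1 ×ˢ ⊤)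
      (𝓤 A.Carrier) := by
  simp only [Bounded, Filter.tendsto_def, Filter.mem_prod_top]
  refine forall₂_congr fun V _ => ⟨?_, fun h => ⟨_, h, fun s hs => hs⟩⟩
  rintro ⟨N, hN, h⟩
  exact Filter.mem_of_superset hN h

theorem initiallyClosed_bounded :
    InitiallyClosed (Bounded : ObjectProperty (UnifFlow P G)) := by
  intro A I Y m hm hY
  rw [bounded_iff_tendsto, ← hm.comap_uniformity, Filter.tendsto_comap_iff, Pi.uniformity,
    Filter.tendsto_iInf]
  intro i
  rw [Filter.tendsto_comap_iff]
  have h := ((bounded_iff_tendsto (Y i)).1 (hY i)).comp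
    ((Filter.tendsto_id (x := 𝓝 (1 : G))).prodMap
      (Filter.tendsto_top (f := mapFun (m i)) (l := (⊤ : Filter A.Carrier))))
  refine h.congr fun p => ?_
  exact Prod.ext (mapFun_smul (m i) p.1 p.2).symm rfl

/-- Chain `(sx, x)`, `(x, y)` and `(y, sy)`, each in `V`. -/
theorem bounded_le_quasiBounded :
    (Bounded : ObjectProperty (UnifFlow P G)) ≤ QuasiBounded := by
  intro A hA W hW
  obtain ⟨V, hV, hVs, hVW⟩ := comp_comp_symm_mem_uniformity_sets hW
  obtain ⟨N, hN, h⟩ := hA V hV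
  exact ⟨N, hN, V, hV, fun s hs x y hxy => hVW <| SetRel.prodMk_mem_comp
    (SetRel.prodMk_mem_comp (h s hs x) hxy) (SetRel.symm V (h s hs y))⟩

/-- Apply uniform continuity to the pairs `((s, y), (1, y))`, which become small as `s` tends to
`1`, uniformly in `y`. All that is needed of `𝒰` is that `(s, 1)` become small. -/
theorem jointlyUniform_le_bounded {𝒰 : UniformSpace G}
    (h𝒰 : Filter.Tendsto (fun s : G => (s, (1 : G))) (𝓝 1) 𝓤[𝒰]) :
    (JointlyUniform 𝒰 : ObjectProperty (UnifFlow P G)) ≤ Bounded := by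
  intro A hA
  rw [bounded_iff_tendsto]
  have h : Filter.Tendsto (fun p : G × A.Carrier => (p, ((1 : G), p.2))) (𝓝 1 ×ˢ ⊤)
      (𝓤 (G × A.Carrier)) := by
    rw [uniformity_prod, Filter.tendsto_inf, Filter.tendsto_comap_iff, Filter.tendsto_comap_iff]
    exact ⟨h𝒰.comp Filter.tendsto_fst, tendsto_diag_uniformity _ _⟩
  refine (Filter.Tendsto.comp hA h).congr fun p => ?_
  exact Prod.ext rfl (one_smul G p.2)

/-- On pairs `(s, 1)` the left and right differences both equal `s⁻¹`; the bilateral uniformity is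
the infimum of the two. -/
theorem tendsto_uniformity_groupUniformity [IsTopologicalGroup G] (w : GroupUniformity) :
    Filter.Tendsto (fun s : G => (s, (1 : G))) (𝓝 1) 𝓤[w.uniformSpace G] := by
  have h : Filter.Tendsto (fun s : G => s⁻¹) (𝓝 1) (𝓝 1) := by
    simpa using (continuous_inv (G := G)).tendsto 1
  have hl : Filter.Tendsto (fun s : G => (s, (1 : G))) (𝓝 1)
      𝓤[IsTopologicalGroup.leftUniformSpace G] :=
    Filter.tendsto_comap_iff.2 (h.congr fun s => (mul_one s⁻¹).symm)
  have hr : Filter.Tendsto (fun s : G => (s, (1 : G))) (𝓝 1)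
      𝓤[IsTopologicalGroup.rightUniformSpace G] :=
    Filter.tendsto_comap_iff.2 (h.congr fun s => (one_mul s⁻¹).symm)
  cases w with
  | left => exact hl
  | right => exact hr
  | bilateral =>
    refine Filter.Tendsto.mono_right ?_ inf_uniformity.ge
    exact Filter.tendsto_inf.2 ⟨hl, hr⟩

end Group

end UnifFlow

/-! ### The translation uniformity -/

section TranslationUniformity

variable (G X : Type*) [Group G] [TopologicalSpace G] [UniformSpace X] [MulAction G X]

/-- The filter on `X × X` with base `{(x, y) | ∃ s t ∈ N, (s • x, t • y) ∈ V}`, for `N` a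
neighborhood of `1` and `V` an entourage. -/
def translationFilter : Filter (X × X) :=
  Filter.map (fun p : (G × G) × (X × X) => (p.1.1⁻¹ • p.2.1, p.1.2⁻¹ • p.2.2))
    ((𝓝 1 ×ˢ 𝓝 1) ×ˢ 𝓤 X)

/-- Substitute `a = sx` and `b = ty` in a pair `(a, b)` of `V`; this is why the defining map uses
inverses. -/
theorem hasBasis_translationFilter : (translationFilter G X).HasBasis
    (fun p : Set G × Set (X × X) => p.1 ∈ 𝓝 (1 : G) ∧ p.2 ∈ 𝓤 X)
    (fun p => {q | ∃ s ∈ p.1, ∃ t ∈ p.1, (s • q.1, t • q.2) ∈ p.2}) := by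
  have h := (((𝓝 (1 : G)).basis_sets.prod_self).prod (𝓤 X).basis_sets).map
    (fun p : (G × G) × (X × X) => (p.1.1⁻¹ • p.2.1, p.1.2⁻¹ • p.2.2))
  refine h.congr (fun _ => Iff.rfl) fun p _ => ?_
  ext ⟨x, y⟩
  constructor
  · rintro ⟨⟨⟨s, t⟩, ⟨a, b⟩⟩, ⟨⟨hs, ht⟩, hab⟩, hxy⟩
    obtain ⟨rfl, rfl⟩ := Prod.ext_iff.1 hxy
    exact ⟨s, hs, t, ht, by simpa using hab⟩
  · rintro ⟨s, hs, t, ht, hst⟩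
    exact ⟨((s, t), (s • x, t • y)), ⟨⟨hs, ht⟩, hst⟩, by simp⟩

variable {G X}

theorem uniformity_le_translationFilter : 𝓤 X ≤ translationFilter G X :=
  (hasBasis_translationFilter G X).ge_iff.2 fun p hp => Filter.mem_of_superset hp.2
    fun q hq => ⟨1, mem_of_mem_nhds hp.1, 1, mem_of_mem_nhds hp.1, by simpa using hq⟩

/-- The uniformity given by the translation filter of a quasi-bounded action. -/
@[reducible] def translationUniformSpace [IsTopologicalGroup G]
    (h : ∀ W ∈ 𝓤 X, ∃ N ∈ 𝓝 (1 : G), ∃ V ∈ 𝓤 X,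
      ∀ s ∈ N, ∀ x y : X, (x, y) ∈ V → (s • x, s • y) ∈ W) : UniformSpace X :=
  .ofCore
    { uniformity := translationFilter G X
      refl := refl_le_uniformity.trans uniformity_le_translationFilter
      symm := by
        refine ((hasBasis_translationFilter G X).tendsto_iff
          (hasBasis_translationFilter G X)).2 fun p hp =>
          ⟨(p.1, Prod.swap ⁻¹' p.2), ⟨hp.1, symm_le_uniformity hp.2⟩, ?_⟩
        rintro ⟨x, y⟩ ⟨s, hs, t, ht, hst⟩
        exact ⟨t, ht, s, hs, hst⟩
      comp := by
        refine (hasBasis_translationFilter G X).ge_iff.2 ?_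
        rintro ⟨N, V⟩ ⟨hN, hV⟩
        -- From `(sx, ty)` in `V₁` and `(s'y, t'z)` in `W`, the idea is to translate the first pair
        -- by `s' / t`. Quasi-boundedness yields `((s' / t) s x, s'y)` in `W`, and composing through
        -- `s'y` lands in `V`. The set `L` is chosen so that `s' / t` lies in both `K` and `N₁`, and
        -- `K` so that `(s' / t) s` lies in `N`.
        obtain ⟨W, hW, hWV⟩ := comp_mem_uniformity_sets hV
        obtain ⟨N₁, hN₁, V₁, hV₁, hq⟩ := h W hW
        obtain ⟨K, hK, hKN⟩ := exists_nhds_one_split hN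
        obtain ⟨L, hL, hLK⟩ := exists_nhds_split_inv (Filter.inter_mem hK hN₁)
        refine Filter.mem_of_superset (Filter.mem_lift'
          ((hasBasis_translationFilter G X).mem_of_mem (i := ((L ∩ K) ∩ N, V₁ ∩ W))
            ⟨Filter.inter_mem (Filter.inter_mem hL hK) hN, Filter.inter_mem hV₁ hW⟩)) ?_
        rintro ⟨x, z⟩ ⟨y, ⟨s, hs, t, ht, hst⟩, ⟨s', hs', t', ht', hst'⟩⟩
        have hd := hLK s' hs'.1.1 t ht.1.1
        refine ⟨s' / t * s, hKN _ hd.1 _ hs.1.2, t', ht'.2, hWV ⟨s' • y, ?_, hst'.2⟩⟩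
        have := hq _ hd.2 _ _ hst.1
        rwa [smul_smul, smul_smul, div_mul_cancel] at this }

/-- Since `g(sx) = (g s g⁻¹)(gx)`, the translating elements are conjugated by `g`, and conjugation
is continuous at `1`. -/
theorem tendsto_smul_translationFilter [IsTopologicalGroup G] [UniformContinuousConstSMul G X]
    (g : G) : Filter.Tendsto (fun q : X × X => (g • q.1, g • q.2)) (translationFilter G X)
      (translationFilter G X) := by
  refine ((hasBasis_translationFilter G X).tendsto_iff (hasBasis_translationFilter G X)).2 ?_
  rintro ⟨N, V⟩ ⟨hN, hV⟩
  have hc : Filter.Tendsto (fun s : G => g * s * g⁻¹) (𝓝 1) (𝓝 1) := by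
    have : Continuous fun s : G => g * s * g⁻¹ := by fun_prop
    simpa using this.tendsto 1
  refine ⟨(_, _), ⟨hc hN, uniformContinuous_const_smul g hV⟩, ?_⟩
  rintro ⟨x, y⟩ ⟨s, hs, t, ht, hst⟩
  refine ⟨_, hs, _, ht, ?_⟩
  have hst' : (g • s • x, g • t • y) ∈ V := hst
  simpa [smul_smul] using hst'

end TranslationUniformity

/-! ### The explicit bounded reflection -/

namespace UnifFlow

variable {P : ObjectProperty UniformSpaceCat.{v}} {G : Type u} [Group G]

theorem mapFun_leftInverse {A B : UnifFlow P G} (e : A ≅ B) :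
    Function.LeftInverse (mapFun e.inv) (mapFun e.hom) := fun x =>
  congrArg (fun k => mapFun k x) e.hom_inv_id

theorem bijective_mapFun_hom {A B : UnifFlow P G} (e : A ≅ B) :
    Function.Bijective (mapFun e.hom) :=
  ⟨(mapFun_leftInverse e).injective, (mapFun_leftInverse e.symm).surjective⟩

theorem comap_mapFun_hom_uniformity {A B : UnifFlow P G} (e : A ≅ B) :
    Filter.comap (Prod.map (mapFun e.hom) (mapFun e.hom)) (𝓤 B.Carrier) = 𝓤 A.Carrier := by
  refine (IsUniformInducing.of_comp (uniformContinuous_mapFun e.hom)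
    (uniformContinuous_mapFun e.inv) ?_).comap_uniformity
  rw [(mapFun_leftInverse e).comp_eq_id]
  exact .id

section Topological

variable [TopologicalSpace G]

/-- Boundedness of `Y` makes `f x` close to `s (f x) = f (sx)` and `f y` close to `t (f y) = f
(ty)`; uniform continuity of `f` bridges the two. -/
theorem tendsto_translationFilter_of_bounded {A Y : UnifFlow P G} (f : A ⟶ Y) (hY : Bounded Y) :
    Filter.Tendsto (fun q : A.Carrier × A.Carrier => (mapFun f q.1, mapFun f q.2))
      (translationFilter G A.Carrier) (𝓤 Y.Carrier) := by
  intro W hW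
  obtain ⟨V, hV, hVs, hVW⟩ := comp_comp_symm_mem_uniformity_sets hW
  obtain ⟨N, hN, h⟩ := hY V hV
  refine (hasBasis_translationFilter G A.Carrier).mem_iff.2
    ⟨(N, _), ⟨hN, uniformContinuous_mapFun f hV⟩, ?_⟩
  rintro ⟨x, y⟩ ⟨s, hs, t, ht, hst⟩
  have hst' : (mapFun f (s • x), mapFun f (t • y)) ∈ V := hst
  rw [mapFun_smul, mapFun_smul] at hst'
  exact hVW (SetRel.prodMk_mem_comp (SetRel.prodMk_mem_comp
    (SetRel.symm V (h s hs (mapFun f x))) hst') (h t ht (mapFun f y)))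

variable [IsTopologicalGroup G]

/-- The flow on the same set as a quasi-bounded flow whose uniformity is given by the translation
filter. -/
def translationFlow (A : UnifFlow (UnifKind.prop.{v} .blank) G) (hA : QuasiBounded A) :
    UnifFlow (UnifKind.prop.{v} .blank) G :=
  @of _ G _ A.Carrier (translationUniformSpace hA) _
    (@UniformContinuousConstSMul.mk _ _ (translationUniformSpace hA) _
      tendsto_smul_translationFilter) trivial

/-- The identity as a morphism from a quasi-bounded flow to the flow given by the translation
filter. -/
def toTranslationFlow (A : UnifFlow (UnifKind.prop.{v} .blank) G) (hA : QuasiBounded A) :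
    A ⟶ translationFlow A hA :=
  homMk (B := translationFlow A hA) id
    (fun _ hW => uniformity_le_translationFilter (G := G) (X := A.Carrier) hW) fun _ _ => rfl

theorem bounded_translationFlow (A : UnifFlow (UnifKind.prop.{v} .blank) G)
    (hA : QuasiBounded A) : Bounded (translationFlow A hA) := by
  intro W hW
  obtain ⟨⟨N, V⟩, ⟨hN, hV⟩, hNV⟩ := (hasBasis_translationFilter G A.Carrier).mem_iff.1 hW
  -- For `s` in `N⁻¹`, translating `sy` by `s⁻¹` and `y` by `1` gives `y` twice.
  refine ⟨N⁻¹, inv_mem_nhds_one G hN, fun s hs y => hNV ?_⟩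
  refine ⟨s⁻¹, hs, 1, mem_of_mem_nhds hN, ?_⟩
  have : (s⁻¹ • s • y, (1 : G) • y) ∈ V := by
    rw [inv_smul_smul, one_smul]
    exact refl_mem_uniformity hV
  exact this

/-- The arrow is the identity on points, so the only candidate factorization is `f` itself, and only
its uniform continuity has to be checked. -/
theorem isUniversalArrow_toTranslationFlow (A : UnifFlow (UnifKind.prop.{v} .blank) G)
    (hA : QuasiBounded A) : IsUniversalArrow Bounded (toTranslationFlow A hA) := by
  refine ⟨bounded_translationFlow A hA, fun Y hY f => ⟨homMk (A := translationFlow A hA)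
    (mapFun (A := A) f) (tendsto_translationFilter_of_bounded f hY) (mapFun_smul f), rfl,
    fun g hg => hom_ext fun x => ?_⟩⟩
  exact congrArg (fun k : A ⟶ Y => mapFun k x) (show toTranslationFlow A hA ≫ g = f from hg)

theorem exists_reflective_bounded :
    ∃ (h : (Bounded : ObjectProperty (UnifFlow (UnifKind.prop.{v} .blank) G)) ≤ QuasiBounded)
      (R : Reflective (ObjectProperty.ιOfLE h)),
      ∀ A : (QuasiBounded :
          ObjectProperty (UnifFlow (UnifKind.prop.{v} .blank) G)).FullSubcategory,
        Function.Bijective (mapFun (R.adj.unit.app A).hom) ∧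
        (Filter.comap (Prod.map (mapFun (R.adj.unit.app A).hom) (mapFun (R.adj.unit.app A).hom))
          (𝓤 (R.L.obj A).obj.Carrier)).HasBasis
          (fun p : Set G × Set (A.obj.Carrier × A.obj.Carrier) =>
            p.1 ∈ 𝓝 (1 : G) ∧ p.2 ∈ 𝓤 A.obj.Carrier)
          (fun p => {q | ∃ s ∈ p.1, ∃ t ∈ p.1,
            (A.obj.act s q.1, A.obj.act t q.2) ∈ p.2}) := by
  obtain ⟨R, hR⟩ := exists_reflective_of_universalArrow bounded_le_quasiBounded
    (fun A : (QuasiBounded :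
        ObjectProperty (UnifFlow (UnifKind.prop.{v} .blank) G)).FullSubcategory =>
      translationFlow A.obj A.property)
    (fun A => toTranslationFlow A.obj A.property)
    (fun A => isUniversalArrow_toTranslationFlow A.obj A.property)
  refine ⟨bounded_le_quasiBounded, R, fun A => ?_⟩
  obtain ⟨e, he⟩ := hR A
  -- The universal arrow is the identity function, so the unit is inverse to `e` on points;
  -- bijectivity and the pulled-back uniformity follow by transport along `e`.
  have hid : mapFun e.hom ∘ mapFun (R.adj.unit.app A).hom = id :=
    congrArg mapFun he
  constructor
  · rw [← (bijective_mapFun_hom e).of_comp_iff', hid]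
    exact Function.bijective_id
  · have hc : Filter.comap
        (Prod.map (mapFun (R.adj.unit.app A).hom) (mapFun (R.adj.unit.app A).hom))
        (𝓤 (R.L.obj A).obj.Carrier) = translationFilter G A.obj.Carrier := by
      rw [← comap_mapFun_hom_uniformity e, Filter.comap_comap, Prod.map_comp_map, hid]
      exact Filter.comap_id
    rw [hc]
    exact hasBasis_translationFilter G A.obj.Carrier

end Topological

end UnifFlow

/-! ### Assembly of the cases -/

theorem theorem2p15 :
    -- topological monoids and topological spaces
    (∀ (M : Type u) [Monoid M] [TopologicalSpace M] [ContinuousMul M] (c : TopKind)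
        (𝒮 𝒥 𝒮' 𝒥' : Set (Set M)), FamilyEnlarges 𝒮 𝒮' → FamilyEnlarges 𝒥 𝒥' →
      IsReflectiveStrengthening
        (TopFlow.Constraint 𝒮 𝒥 : ObjectProperty (TopFlow (TopKind.prop.{v} c) M))
        (TopFlow.Constraint 𝒮' 𝒥')) ∧
    -- monoids with a uniformity and uniform spaces
    (∀ (M : Type u) [Monoid M] [UniformSpace M] (c : UnifKind)
        (𝒮 𝒥 𝒮' 𝒥' : Set (Set M)), FamilyEnlarges 𝒮 𝒮' → FamilyEnlarges 𝒥 𝒥' →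
      IsReflectiveStrengthening
        (UnifFlow.Constraint 𝒮 𝒥 : ObjectProperty (UnifFlow (UnifKind.prop.{v} c) M))
        (UnifFlow.Constraint 𝒮' 𝒥')) ∧
    -- compactly generated monoids and spaces
    (∀ (M : Type u) [Monoid M] [TopologicalSpace M] [IsKMonoid M] (c : KTopKind)
        (𝒮 𝒥 𝒮' 𝒥' : Set (Set M)), FamilyEnlarges 𝒮 𝒮' → FamilyEnlarges 𝒥 𝒥' →
      IsReflectiveStrengthening
        (TopFlow.KConstraint 𝒮 𝒥 : ObjectProperty (TopFlow (KTopKind.prop.{v} c) M))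
        (TopFlow.KConstraint 𝒮' 𝒥')) ∧
    -- topological groups: from quasi-bounded to bounded, from bounded to jointly uniform
    (∀ (G : Type u) [Group G] [TopologicalSpace G] [IsTopologicalGroup G] (c : UnifKind),
      IsReflectiveStrengthening
        (UnifFlow.QuasiBounded : ObjectProperty (UnifFlow (UnifKind.prop.{v} c) G))
        UnifFlow.Bounded ∧
      ∀ w : GroupUniformity,
        IsReflectiveStrengthening
          (UnifFlow.Bounded : ObjectProperty (UnifFlow (UnifKind.prop.{v} c) G))
          (UnifFlow.JointlyUniform (w.uniformSpace G))) ∧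
    -- in `Unif`, the reflection of a quasi-bounded flow keeps the underlying flow and coarsens the
    -- uniformity to the one with base `{(x, y) | ∃ s t ∈ N, (s x, t y) ∈ V}`
    (∀ (G : Type u) [Group G] [TopologicalSpace G] [IsTopologicalGroup G],
      ∃ (h : (UnifFlow.Bounded : ObjectProperty (UnifFlow (UnifKind.prop.{v} .blank) G)) ≤
            UnifFlow.QuasiBounded)
        (R : Reflective (ObjectProperty.ιOfLE h)),
        ∀ A : (UnifFlow.QuasiBounded :
            ObjectProperty (UnifFlow (UnifKind.prop.{v} .blank) G)).FullSubcategory,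
          Function.Bijective (UnifFlow.mapFun (R.adj.unit.app A).hom) ∧
          (Filter.comap (Prod.map (UnifFlow.mapFun (R.adj.unit.app A).hom)
              (UnifFlow.mapFun (R.adj.unit.app A).hom))
            (𝓤 (R.L.obj A).obj.Carrier)).HasBasis
            (fun p : Set G × Set (A.obj.Carrier × A.obj.Carrier) =>
              p.1 ∈ 𝓝 (1 : G) ∧ p.2 ∈ 𝓤 A.obj.Carrier)
            (fun p => {q | ∃ s ∈ p.1, ∃ t ∈ p.1,
              (A.obj.act s q.1, A.obj.act t q.2) ∈ p.2})) := by
  refine ⟨?_, ?_, ?_, ?_, ?_⟩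
  · intro M _ _ _ c 𝒮 𝒥 𝒮' 𝒥' hS hJ
    exact TopFlow.isReflectiveStrengthening_constraint c hS hJ
  · intro M _ _ c 𝒮 𝒥 𝒮' 𝒥' hS hJ
    exact UnifFlow.isReflectiveStrengthening_of_initiallyClosed (UnifFlow.constraint_le hS hJ)
      UnifFlow.initiallyClosed_constraint
  · intro M _ _ _ c 𝒮 𝒥 𝒮' 𝒥' hS hJ
    exact TopFlow.isReflectiveStrengthening_kConstraint c hS hJ
  · intro G _ _ _ c
    exact ⟨UnifFlow.isReflectiveStrengthening_of_initiallyClosed UnifFlow.bounded_le_quasiBounded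
      UnifFlow.initiallyClosed_bounded, fun w =>
      UnifFlow.isReflectiveStrengthening_of_initiallyClosed
        (UnifFlow.jointlyUniform_le_bounded (UnifFlow.tendsto_uniformity_groupUniformity w))
        (UnifFlow.initiallyClosed_jointlyUniform _)⟩
  · intro G _ _ _
    exact UnifFlow.exists_reflective_bounded
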